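/- Let $p$ be a probability distribution on the 16 boolean functions $f:\{0,1\}^2\to\{0,1\}$. Call $f$ canalyzing if there are an argument $x_m$ ($m\in\{1,2\}$) and values $u,v\in\{0,1\}$ such that $f(x_1,x_2)=v$ whenever $x_m=u$. Let $\mathcal A$ be the set of the two constant functions, $\mathcal B_1$ the set of the four canalyzing functions that depend on exactly one argument, $\mathcal B_2$ the set of the eight canalyzing functions that depend on both arguments, and $\mathcal C$ the set of the two non-canalyzing functions (equivalence and exclusive or). Assume that $p(f)=p(\neg f)$ for all $f\in\mathcal A\cup\mathcal B_2$, and that $p(f)=p(f')$ for all $f\in\mathcal B_1$, where $f'(x,y)=f(y,x)$. Put $a=\sum_{f\in\mathcal A}p(f)$ and $c=\sum_{f\in\mathcal C}p(f)$. The random boolean cellular automaton $\tilde B$ with $n\ge 2$ gates $1,\dots,n$ is generated as follows. Independently for each gate $i$, an unordered pair of distinct gates, with elements $j_i<k_i$, is chosen uniformly among the $\binom n2$ possibilities ($i$ itself may belong to it), and a boolean function $f_i$ is chosen with distribution $p$, independently of all the other choices. A boolean cellular automaton $B$ acts on states $x\in\{0,1\}^n$ by $B(x)=(f_1(x_{j_1},x_{k_1}),\dots,f_n(x_{j_n},x_{k_n}))$;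 $B^t$ is its $t$-th iterate. Gate $i$ of $B$ is weak if for every $x\in\{0,1\}^n$, with $\overline{x}^i$ denoting $x$ with its $i$-th component replaced by $1-x_i$, there are integers $t_0,d\ge 0$ such that $B^t(x)=B^{t+d}(\overline{x}^i)$ for all $t\ge t_0$; that is, flipping the initial state of $i$ does not change the state cycle that is eventually entered. Theorem 4.5. If $a>c$, then there exists $\alpha>0$ such that $$\lim_{n\to\infty}\Pr\bigl(\tilde B\text{ has at least }n(1-n^{-\alpha})\text{ weak gates}\bigr)=1.$$ -/

import Mathlib

open Filter Topology

namespace BCA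

/-- Boolean functions of two arguments. -/
abbrev BoolFun : Type := Bool → Bool → Bool

/-- `f` depends on its first argument. -/
def DependsFst (f : BoolFun) : Prop := ∃ v, f false v ≠ f true v

/-- `f` depends on its second argument. -/
def DependsSnd (f : BoolFun) : Prop := ∃ v, f v false ≠ f v true

/-- `f` is canalyzing: some value `u` of one of the arguments guarantees some value `v` of `f`. -/
def Canalyzing (f : BoolFun) : Prop :=
  (∃ u v, ∀ x₁ x₂, x₁ = u → f x₁ x₂ = v) ∨ (∃ u v, ∀ x₁ x₂, x₂ = u → f x₁ x₂ = v)

/-- The class of the two constant functions. -/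
def classA : Set BoolFun := {f | ∃ v, ∀ x₁ x₂, f x₁ x₂ = v}

/-- The class of the four canalyzing functions that depend on exactly one argument. -/
def classB₁ : Set BoolFun := {f | Canalyzing f ∧ Xor (DependsFst f) (DependsSnd f)}

/-- The class of the eight canalyzing functions that depend on both arguments. -/
def classB₂ : Set BoolFun := {f | Canalyzing f ∧ DependsFst f ∧ DependsSnd f}

/-- The class of the two non-canalyzing functions. -/
def classC : Set BoolFun := {f | ¬ Canalyzing f}

/-- The negation of a boolean function. -/
def neg (f : BoolFun) : BoolFun := fun x y => !(f x y)

/-- The boolean function with its two arguments exchanged. -/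
def swap (f : BoolFun) : BoolFun := fun x y => f y x

/-- `p` is a probability distribution on the boolean functions of two arguments. -/
def IsDistribution (p : BoolFun → ℝ) : Prop := (∀ f, 0 ≤ p f) ∧ ∑ f, p f = 1

/-- The symmetry conditions on the distribution of the boolean functions. -/
def IsSymmetric (p : BoolFun → ℝ) : Prop :=
  (∀ f ∈ classA ∪ classB₂, p f = p (neg f)) ∧ (∀ f ∈ classB₁, p f = p (swap f))

open Classical in
/-- The probability that a function drawn from `p` belongs to the class `S`. -/
noncomputable def classProb (p : BoolFun → ℝ) (S : Set BoolFun) : ℝ :=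
  ∑ f, if f ∈ S then p f else 0

/-- The possible pairs of inputs `j < k` of a gate, among `n` gates. -/
abbrev InputPair (n : ℕ) : Type := {e : Fin n × Fin n // e.1 < e.2}

/-- A boolean cellular automaton with `n` gates, each of indegree two: the digraph, given by the
two inputs of each gate, and the boolean function of each gate. -/
abbrev Automaton (n : ℕ) : Type := (Fin n → InputPair n) × (Fin n → BoolFun)

/-- The map on states defined by the automaton. -/
def step {n : ℕ} (B : Automaton n) (x : Fin n → Bool) : Fin n → Bool :=
  fun i => B.2 i (x (B.1 i).1.1) (x (B.1 i).1.2)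

/-- The state at time `t`, from the initial state `x`. -/
def stateAt {n : ℕ} (B : Automaton n) (t : ℕ) (x : Fin n → Bool) : Fin n → Bool :=
  (step B)^[t] x

/-- The state `x` with its component `i` flipped. -/
def flip {n : ℕ} (x : Fin n → Bool) (i : Fin n) : Fin n → Bool :=
  Function.update x i (!(x i))

/-- Gate `i` is weak: for every initial state, flipping the state of `i` does not affect the
state cycle that is entered. -/
def IsWeak {n : ℕ} (B : Automaton n) (i : Fin n) : Prop :=
  ∀ x : Fin n → Bool, ∃ t₀ d : ℕ, ∀ t, t₀ ≤ t → stateAt B t x = stateAt B (t + d) (flip x i)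

/-- The probability of the single automaton `B`: independently for each gate, its inputs are one
of the `n.choose 2` equally likely pairs, and its boolean function has the distribution `p`. -/
noncomputable def weight (p : BoolFun → ℝ) {n : ℕ} (B : Automaton n) : ℝ :=
  ∏ i, (1 / (n.choose 2 : ℝ) * p (B.2 i))

open Classical in
/-- The probability that the random automaton with `n` gates has the property `P`. (For `n = 1`
there are no automata.) -/
noncomputable def pr (p : BoolFun → ℝ) (n : ℕ) (P : Automaton n → Prop) : ℝ :=
  ∑ B : Automaton n, if P B then weight p B else 0

end BCA

/-! A gate that influences no gate at some time `t` is weak, because the two trajectories agree from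
then on. So the gates that are not weak are at most as many as the pairs (i, g) for which flipping i
can change g at time `t`, and it suffices that a typical g has few influencers at a time of order
log n.

The state of g at time `t` is computed by a binary tree of choices. As long as no gate occurs twice
among its inner nodes, these choices are independent; by `collisionProb_le` a repetition has
probability O(4^t / n).

In the independent tree, constant functions force values (`rootValue`), and the symmetry of `p`
makes both forced values equally likely. Let m be the probability that nothing is forced. A
constant, canalyzing nonconstant or non-canalyzing function has `gain` 0, 1 or 2. It multiplies m by
at most its gain, so m ≤ (1 - a + c)^t (`valueProb_none_le`), and it passes a perturbation through
at most gain + m arguments on average. Hence the expected influence is multiplied by at most `rate p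
+ rate p ^ t` per level (`expInfluence_succ_le`). As 1 - a + c < 1, it decays geometrically.

A collision costs at most the trivial bound 2^t, so the expected number of gates that are not weak
is at most n(Cμ^t + O(8^t / n)). With t ≈ log n / log 64 this is n to a power below 1, and Markov's
inequality concludes. -/

namespace BCA

/-! ### Unfolding trees, forced values and influence -/

/-- The choice made for one gate: its inputs and its boolean function. -/
abbrev Choice (n : ℕ) : Type := InputPair n × BoolFun

/-- Binary trees of depth `t` whose nodes carry choices of inputs and boolean functions. -/
def Unfolding (n : ℕ) : ℕ → Type
  | 0 => Unit
  | t + 1 => Choice n × Unfolding n t × Unfolding n t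

instance unfoldingFintype (n : ℕ) : ∀ t, Fintype (Unfolding n t)
  | 0 => inferInstanceAs (Fintype Unit)
  | t + 1 =>
    letI := unfoldingFintype n t
    inferInstanceAs (Fintype (Choice n × Unfolding n t × Unfolding n t))

/-- The tree of the choices that determine the state of the gate `g` at time `t`. -/
def unfold {n : ℕ} (B : Automaton n) : (t : ℕ) → Fin n → Unfolding n t
  | 0, _ => ()
  | t + 1, g => ((B.1 g, B.2 g), unfold B t (B.1 g).1.1, unfold B t (B.1 g).1.2)

/-- The value `y` is allowed by the partial information `o`. -/
def Compat (o : Option Bool) (y : Bool) : Prop := o = none ∨ o = some y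

instance (o : Option Bool) (y : Bool) : Decidable (Compat o y) :=
  inferInstanceAs (Decidable (_ ∨ _))

/-- The value of `f` that is forced by partial information on its arguments, if there is one. -/
def forced (f : BoolFun) (o₁ o₂ : Option Bool) : Option Bool :=
  if ∀ x y, Compat o₁ x → Compat o₂ y → f x y = true then some true
  else if ∀ x y, Compat o₁ x → Compat o₂ y → f x y = false then some false
  else none

/-- `f` may depend on its first argument, given partial information on the second one. -/
def PassesFst (f : BoolFun) (o : Option Bool) : Prop := ∃ y, Compat o y ∧ f false y ≠ f true y

/-- `f` may depend on its second argument, given partial information on the first one. -/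
def PassesSnd (f : BoolFun) (o : Option Bool) : Prop := ∃ x, Compat o x ∧ f x false ≠ f x true

instance (f : BoolFun) (o : Option Bool) : Decidable (PassesFst f o) :=
  inferInstanceAs (Decidable (∃ _, _))

instance (f : BoolFun) (o : Option Bool) : Decidable (PassesSnd f o) :=
  inferInstanceAs (Decidable (∃ _, _))

/-- The value forced at the root of a tree, whatever the values at the leaves are. -/
def rootValue {n : ℕ} : (t : ℕ) → Unfolding n t → Option Bool
  | 0, _ => none
  | t + 1, (c, l, r) => forced c.2 (rootValue t l) (rootValue t r)

/-- A bound for the number of leaves that influence the value at the root. -/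
def influence {n : ℕ} : (t : ℕ) → Unfolding n t → ℕ
  | 0, _ => 1
  | t + 1, (c, l, r) =>
    (if PassesFst c.2 (rootValue t r) then influence t l else 0) +
      (if PassesSnd c.2 (rootValue t l) then influence t r else 0)

lemma influence_le {n : ℕ} : ∀ (t : ℕ) (τ : Unfolding n t), influence t τ ≤ 2 ^ t
  | 0, _ => le_rfl
  | t + 1, (c, l, r) => by
    have hl := influence_le t l
    have hr := influence_le t r
    simp only [influence]
    split_ifs <;> omega

lemma compat_forced (f : BoolFun) (o₁ o₂ : Option Bool) (x y : Bool)
    (hx : Compat o₁ x) (hy : Compat o₂ y) : Compat (forced f o₁ o₂) (f x y) := by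
  unfold forced
  split_ifs with h₁ h₂
  · exact Or.inr (by rw [h₁ x y hx hy])
  · exact Or.inr (by rw [h₂ x y hx hy])
  · exact Or.inl rfl

lemma stateAt_succ_apply {n : ℕ} (B : Automaton n) (t : ℕ) (x : Fin n → Bool) (g : Fin n) :
    stateAt B (t + 1) x g =
      B.2 g (stateAt B t x (B.1 g).1.1) (stateAt B t x (B.1 g).1.2) := by
  unfold stateAt
  rw [Function.iterate_succ_apply']
  rfl

lemma compat_rootValue {n : ℕ} (B : Automaton n) (x : Fin n → Bool) (t : ℕ) (g : Fin n) :
    Compat (rootValue t (unfold B t g)) (stateAt B t x g) := by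
  induction t generalizing g with
  | zero => exact Or.inl rfl
  | succ t ih =>
    rw [stateAt_succ_apply]
    exact compat_forced _ _ _ _ _ (ih _) (ih _)

/-- The gates whose initial state may affect the state of `g` at time `t`. -/
def influencers {n : ℕ} (B : Automaton n) (t : ℕ) (g : Fin n) : Set (Fin n) :=
  {i | ∃ x, stateAt B t x g ≠ stateAt B t (flip x i) g}

/-- The arguments are changed one at a time, from (y₁, y₂) through (z₁, y₂) to (z₁, z₂), and one of
the two changes alters the output. The argument held fixed comes from a genuine trajectory, flipped
or not, so it is compatible with the forced value. -/
lemma influencers_succ_subset {n : ℕ} (B : Automaton n) (t : ℕ) (g : Fin n) :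
    influencers B (t + 1) g ⊆
      (if PassesFst (B.2 g) (rootValue t (unfold B t (B.1 g).1.2)) then
        influencers B t (B.1 g).1.1 else ∅) ∪
      (if PassesSnd (B.2 g) (rootValue t (unfold B t (B.1 g).1.1)) then
        influencers B t (B.1 g).1.2 else ∅) := by
  rintro i ⟨x, hx⟩
  rw [stateAt_succ_apply, stateAt_succ_apply] at hx
  have h₁ := compat_rootValue B (flip x i) t (B.1 g).1.1
  have h₂ := compat_rootValue B x t (B.1 g).1.2
  have e₁ : stateAt B t x (B.1 g).1.1 ≠ stateAt B t (flip x i) (B.1 g).1.1 →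
      i ∈ influencers B t (B.1 g).1.1 := fun h => ⟨x, h⟩
  have e₂ : stateAt B t x (B.1 g).1.2 ≠ stateAt B t (flip x i) (B.1 g).1.2 →
      i ∈ influencers B t (B.1 g).1.2 := fun h => ⟨x, h⟩
  generalize stateAt B t x (B.1 g).1.1 = y₁ at *
  generalize stateAt B t x (B.1 g).1.2 = y₂ at *
  generalize stateAt B t (flip x i) (B.1 g).1.1 = z₁ at *
  generalize stateAt B t (flip x i) (B.1 g).1.2 = z₂ at *
  by_cases hy : B.2 g y₁ y₂ = B.2 g z₁ y₂
  · right
    have hne : B.2 g z₁ y₂ ≠ B.2 g z₁ z₂ := by rwa [← hy]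
    have h : y₂ ≠ z₂ := fun h => hne (by rw [h])
    rw [if_pos]
    · exact e₂ h
    · refine ⟨z₁, h₁, ?_⟩
      cases y₂ <;> cases z₂ <;> simp_all [eq_comm]
  · left
    have h : y₁ ≠ z₁ := fun h => hy (by rw [h])
    rw [if_pos]
    · exact e₁ h
    · refine ⟨y₂, h₂, ?_⟩
      cases y₁ <;> cases z₁ <;> simp_all [eq_comm]

lemma ncard_influencers_le {n : ℕ} (B : Automaton n) (t : ℕ) (g : Fin n) :
    (influencers B t g).ncard ≤ influence t (unfold B t g) := by
  induction t generalizing g with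
  | zero =>
    have : influencers B 0 g ⊆ {g} := by
      rintro i ⟨x, hx⟩
      by_contra hi
      exact hx (by simp [stateAt, flip, Function.update_of_ne (Ne.symm hi)])
    simpa [influence] using Set.ncard_le_ncard this
  | succ t ih =>
    refine (Set.ncard_le_ncard (influencers_succ_subset B t g)).trans
      ((Set.ncard_union_le _ _).trans ?_)
    simp only [influence, unfold]
    gcongr
    · split_ifs
      · exact ih _
      · simp
    · split_ifs
      · exact ih _
      · simp

/-- A gate that influences nothing at time `t` is weak with no time shift: equal states at time `t`
stay equal. -/
lemma ncard_not_isWeak_le {n : ℕ} (B : Automaton n) (t : ℕ) :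
    {i | ¬ IsWeak B i}.ncard ≤ ∑ g, influence t (unfold B t g) := by
  have hsub : {i | ¬ IsWeak B i} ⊆ ⋃ g ∈ (Finset.univ : Finset (Fin n)), influencers B t g := by
    intro i hi
    by_contra hne
    refine hi fun x => ⟨t, 0, fun s hs => ?_⟩
    have key : stateAt B t x = stateAt B t (flip x i) := by
      funext g
      by_contra hg
      exact hne (Set.mem_biUnion (Finset.mem_univ g) ⟨x, hg⟩)
    obtain ⟨k, rfl⟩ := Nat.exists_eq_add_of_le hs
    rw [add_zero, add_comm]
    unfold stateAt at *
    rw [Function.iterate_add_apply, Function.iterate_add_apply, key]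
  refine (Set.ncard_le_ncard hsub).trans ?_
  refine (Finset.set_ncard_biUnion_le _ _).trans ?_
  exact Finset.sum_le_sum fun g _ => ncard_influencers_le B t g

/-! ### Labels, and trees with independent choices -/

/-- The node labels and choices in a tree whose root is the gate `g`. -/
def entries {n : ℕ} : (t : ℕ) → Unfolding n t → Fin n → List (Fin n × Choice n)
  | 0, _, _ => []
  | t + 1, (c, l, r), g => (g, c) :: (entries t l c.1.1.1 ++ entries t r c.1.1.2)

/-- The labels of the inner nodes of a tree whose root is the gate `g`. -/
def labels {n : ℕ} (t : ℕ) (τ : Unfolding n t) (g : Fin n) : List (Fin n) :=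
  (entries t τ g).map Prod.fst

lemma labels_succ {n : ℕ} (t : ℕ) (c : Choice n) (l r : Unfolding n t) (g : Fin n) :
    labels (t + 1) (c, l, r) g = g :: (labels t l c.1.1.1 ++ labels t r c.1.1.2) := by
  simp [labels, entries]

/-- Turns an unfolding event into constraints on single gates, which are independent when the labels
are distinct. -/
lemma unfold_eq_iff {n : ℕ} (B : Automaton n) :
    ∀ (t : ℕ) (τ : Unfolding n t) (g : Fin n),
      unfold B t g = τ ↔ ∀ e ∈ entries t τ g, (B.1 e.1, B.2 e.1) = e.2
  | 0, _, _ => by simp [entries]; rfl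
  | t + 1, (c, l, r), g => by
    simp only [entries, List.forall_mem_cons, List.forall_mem_append, ← unfold_eq_iff B t]
    constructor
    · intro h
      have h₁ : (B.1 g, B.2 g) = c := congrArg Prod.fst h
      have h₂ : unfold B t (B.1 g).1.1 = l := congrArg (fun τ => τ.2.1) h
      have h₃ : unfold B t (B.1 g).1.2 = r := congrArg (fun τ => τ.2.2) h
      subst h₁
      exact ⟨rfl, h₂, h₃⟩
    · rintro ⟨rfl, rfl, rfl⟩
      rfl

/-- The probability of a choice for a single gate. -/
noncomputable def choiceWeight (p : BoolFun → ℝ) {n : ℕ} (c : Choice n) : ℝ :=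
  1 / (n.choose 2 : ℝ) * p c.2

/-- The probability of a tree all of whose choices are independent. -/
noncomputable def treeWeight (p : BoolFun → ℝ) {n : ℕ} : (t : ℕ) → Unfolding n t → ℝ
  | 0, _ => 1
  | t + 1, (c, l, r) => choiceWeight p c * (treeWeight p t l * treeWeight p t r)

/-- The expectation of `φ` for a random tree all of whose choices are independent. -/
noncomputable def treeExp (p : BoolFun → ℝ) {n : ℕ} (t : ℕ) (φ : Unfolding n t → ℝ) : ℝ :=
  ∑ τ, treeWeight p t τ * φ τ

/-- The expectation of `φ` for the random automaton. -/
noncomputable def autExp (p : BoolFun → ℝ) {n : ℕ} (φ : Automaton n → ℝ) : ℝ :=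
  ∑ B, weight p B * φ B

lemma card_inputPair (n : ℕ) : Fintype.card (InputPair n) = n.choose 2 := by
  rw [Fintype.card_subtype, Fintype.card_product_filter_lt, Fintype.card_fin]


lemma choose_two_pos {n : ℕ} (hn : 2 ≤ n) : (0 : ℝ) < n.choose 2 := by
  exact_mod_cast Nat.choose_pos hn

lemma sum_choiceWeight_mul_snd (p : BoolFun → ℝ) {n : ℕ} (hn : 2 ≤ n) (φ : BoolFun → ℝ) :
    ∑ c : Choice n, choiceWeight p c * φ c.2 = ∑ f, p f * φ f := by
  have hK := choose_two_pos hn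
  simp only [Fintype.sum_prod_type, choiceWeight, Finset.sum_const, Finset.card_univ,
    card_inputPair, nsmul_eq_mul, mul_assoc, ← Finset.mul_sum]
  field_simp

lemma sum_choiceWeight_mul_fst {p : BoolFun → ℝ} (hp : IsDistribution p) {n : ℕ}
    (φ : InputPair n → ℝ) :
    ∑ c : Choice n, choiceWeight p c * φ c.1 = 1 / (n.choose 2 : ℝ) * ∑ e, φ e := by
  simp only [Fintype.sum_prod_type, choiceWeight, Finset.mul_sum]
  refine Finset.sum_congr rfl fun e _ => ?_
  rw [← Finset.sum_mul, ← Finset.mul_sum, hp.2, mul_one]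

lemma sum_choiceWeight {p : BoolFun → ℝ} (hp : IsDistribution p) {n : ℕ} (hn : 2 ≤ n) :
    ∑ c : Choice n, choiceWeight p c = 1 := by
  simpa [hp.2] using sum_choiceWeight_mul_snd p hn fun _ => 1

lemma choiceWeight_nonneg {p : BoolFun → ℝ} (hp : IsDistribution p) {n : ℕ} (c : Choice n) :
    0 ≤ choiceWeight p c :=
  mul_nonneg (by positivity) (hp.1 _)

lemma treeWeight_nonneg {p : BoolFun → ℝ} (hp : IsDistribution p) {n : ℕ} :
    ∀ (t : ℕ) (τ : Unfolding n t), 0 ≤ treeWeight p t τ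
  | 0, _ => zero_le_one
  | t + 1, (c, l, r) => mul_nonneg (choiceWeight_nonneg hp c)
      (mul_nonneg (treeWeight_nonneg hp t l) (treeWeight_nonneg hp t r))

lemma treeWeight_eq_prod (p : BoolFun → ℝ) {n : ℕ} :
    ∀ (t : ℕ) (τ : Unfolding n t) (g : Fin n),
      treeWeight p t τ = ((entries t τ g).map fun e => choiceWeight p e.2).prod
  | 0, _, _ => by simp [treeWeight, entries]
  | t + 1, (c, l, r), g => by
    simp [treeWeight, entries, treeWeight_eq_prod p t l c.1.1.1,
      treeWeight_eq_prod p t r c.1.1.2]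

section treeExp

variable (p : BoolFun → ℝ) {n : ℕ} (t : ℕ)

lemma treeExp_zero (φ : Unfolding n 0 → ℝ) : treeExp p 0 φ = φ () := by
  change ∑ τ : Unit, treeWeight p 0 τ * φ τ = _
  rw [Fintype.sum_unique]
  exact one_mul _

lemma treeExp_succ (φ : Unfolding n (t + 1) → ℝ) :
    treeExp p (t + 1) φ =
      ∑ c, choiceWeight p c * treeExp p t fun l => treeExp p t fun r => φ (c, l, r) := by
  change ∑ τ : Choice n × Unfolding n t × Unfolding n t, treeWeight p (t + 1) τ * φ τ = _
  simp only [Fintype.sum_prod_type, treeExp, treeWeight, Finset.mul_sum, mul_assoc]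

lemma treeExp_add (φ ψ : Unfolding n t → ℝ) :
    treeExp p t (fun τ => φ τ + ψ τ) = treeExp p t φ + treeExp p t ψ := by
  simp [treeExp, mul_add, Finset.sum_add_distrib]

lemma treeExp_const_mul (a : ℝ) (φ : Unfolding n t → ℝ) :
    treeExp p t (fun τ => a * φ τ) = a * treeExp p t φ := by
  simp [treeExp, Finset.mul_sum, mul_left_comm]

lemma treeExp_mul_const (a : ℝ) (φ : Unfolding n t → ℝ) :
    treeExp p t (fun τ => φ τ * a) = treeExp p t φ * a := by
  simp [treeExp, Finset.sum_mul, mul_assoc]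

lemma treeExp_sum {ι : Type*} (s : Finset ι) (φ : ι → Unfolding n t → ℝ) :
    treeExp p t (fun τ => ∑ i ∈ s, φ i τ) = ∑ i ∈ s, treeExp p t (φ i) := by
  simp only [treeExp, Finset.mul_sum]
  exact Finset.sum_comm

variable {p}

lemma treeExp_mono (hp : IsDistribution p) {φ ψ : Unfolding n t → ℝ} (h : ∀ τ, φ τ ≤ ψ τ) :
    treeExp p t φ ≤ treeExp p t ψ :=
  Finset.sum_le_sum fun τ _ => mul_le_mul_of_nonneg_left (h τ) (treeWeight_nonneg hp t τ)

lemma treeExp_nonneg (hp : IsDistribution p) {φ : Unfolding n t → ℝ} (h : ∀ τ, 0 ≤ φ τ) :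
    0 ≤ treeExp p t φ :=
  Finset.sum_nonneg fun τ _ => mul_nonneg (treeWeight_nonneg hp t τ) (h τ)

lemma treeExp_const (hp : IsDistribution p) (hn : 2 ≤ n) (a : ℝ) :
    treeExp p t (fun _ : Unfolding n t => a) = a := by
  induction t with
  | zero => exact treeExp_zero p _
  | succ t ih => rw [treeExp_succ, ih, ih, ← Finset.sum_mul, sum_choiceWeight hp hn, one_mul]

end treeExp

/-! ### Probability of a repeated label -/

lemma two_mul_sum_inputPair {n : ℕ} (ψ : Fin n → Fin n → ℝ) (h : ∀ j k, ψ j k = ψ k j) :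
    2 * ∑ e : InputPair n, ψ e.1.1 e.1.2 = ∑ j, ∑ k, if j ≠ k then ψ j k else 0 := by
  have h₁ : ∑ e : InputPair n, ψ e.1.1 e.1.2 = ∑ j, ∑ k, if j < k then ψ j k else 0 := by
    rw [← Fintype.sum_prod_type' (fun j k => if j < k then ψ j k else 0),
      ← Finset.sum_filter]
    exact (Finset.sum_subtype _ (by simp) fun e : Fin n × Fin n => ψ e.1 e.2).symm
  have h₂ : ∑ e : InputPair n, ψ e.1.1 e.1.2 = ∑ j, ∑ k, if k < j then ψ j k else 0 := by
    rw [h₁, Finset.sum_comm]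
    simp only [h]
  rw [two_mul]
  nth_rewrite 1 [h₁]
  rw [h₂, ← Finset.sum_add_distrib]
  refine Finset.sum_congr rfl fun j _ => ?_
  rw [← Finset.sum_add_distrib]
  refine Finset.sum_congr rfl fun k _ => ?_
  rcases lt_trichotomy j k with hjk | rfl | hjk
  · simp [hjk, hjk.not_gt, hjk.ne]
  · simp
  · simp [hjk, hjk.not_gt, hjk.ne']

/-- Passing to ordered pairs and adding the nonnegative diagonal lets the two indices be summed
independently. -/
lemma pair_average_le {n : ℕ} (hn : 2 ≤ n) (ψ : Fin n → Fin n → ℝ) (h : ∀ j k, ψ j k = ψ k j)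
    (h0 : ∀ j, 0 ≤ ψ j j) :
    1 / (n.choose 2 : ℝ) * ∑ e : InputPair n, ψ e.1.1 e.1.2 ≤
      1 / (n * (n - 1)) * ∑ j, ∑ k, ψ j k := by
  have hle : 2 * ∑ e : InputPair n, ψ e.1.1 e.1.2 ≤ ∑ j, ∑ k, ψ j k := by
    rw [two_mul_sum_inputPair ψ h]
    refine Finset.sum_le_sum fun j _ => Finset.sum_le_sum fun k _ => ?_
    split_ifs with hjk
    · exact le_rfl
    · rw [not_not.1 hjk]
      exact h0 k
  have hn' : (2 : ℝ) ≤ n := by exact_mod_cast hn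
  have hpos : (0 : ℝ) < n * (n - 1) := by nlinarith
  rw [Nat.cast_choose_two]
  calc _ = 1 / (n * ((n : ℝ) - 1)) * (2 * ∑ e : InputPair n, ψ e.1.1 e.1.2) := by
        field_simp
    _ ≤ _ := by gcongr

lemma pair_average_add {n : ℕ} (hn : 2 ≤ n) (φ : Fin n → ℝ) :
    1 / (n.choose 2 : ℝ) * ∑ e : InputPair n, (φ e.1.1 + φ e.1.2) = 2 / n * ∑ j, φ j := by
  have hn' : (2 : ℝ) ≤ n := by exact_mod_cast hn
  have hpos : (0 : ℝ) < n - 1 := by linarith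
  have key : 2 * ∑ e : InputPair n, (φ e.1.1 + φ e.1.2) = 2 * ((n - 1) * ∑ j, φ j) := by
    rw [two_mul_sum_inputPair (fun j k => φ j + φ k) fun j k => add_comm _ _]
    have : ∀ j k, (if j ≠ k then φ j + φ k else 0) =
        φ j + φ k - if j = k then φ j + φ k else 0 := by
      intro j k
      split_ifs <;> simp_all
    simp only [this, Finset.sum_sub_distrib, Finset.sum_add_distrib, Finset.sum_ite_eq,
      Finset.mem_univ, if_true, Finset.sum_const, Finset.card_univ, Fintype.card_fin,
      nsmul_eq_mul, ← Finset.mul_sum]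
    ring
  rw [mul_left_cancel₀ two_ne_zero key, Nat.cast_choose_two]
  field_simp

/-- The expected number of nodes with label `v` in a tree with root `g`. -/
noncomputable def expCount (p : BoolFun → ℝ) {n : ℕ} (t : ℕ) (g v : Fin n) : ℝ :=
  treeExp p t fun τ => ((labels t τ g).count v : ℝ)

/-- The probability that the labels in a tree with root `g` are not distinct. -/
noncomputable def collisionProb (p : BoolFun → ℝ) {n : ℕ} (t : ℕ) (g : Fin n) : ℝ :=
  treeExp p t fun τ => if (labels t τ g).Nodup then 0 else 1

lemma expCount_succ {p : BoolFun → ℝ} (hp : IsDistribution p) {n : ℕ} (hn : 2 ≤ n)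
    (t : ℕ) (g v : Fin n) :
    expCount p (t + 1) g v = (if g = v then 1 else 0) + 2 / n * ∑ j, expCount p t j v := by
  have h : ∀ c : Choice n, (treeExp p t fun l => treeExp p t fun r =>
      ((labels (t + 1) ((c, l, r) : Unfolding n (t + 1)) g).count v : ℝ)) =
      (if g = v then 1 else 0) + (expCount p t c.1.1.1 v + expCount p t c.1.1.2 v) := by
    intro c
    simp only [labels_succ, List.count_cons, List.count_append, Nat.cast_add, treeExp_add,
      treeExp_const t hp hn, beq_iff_eq, Nat.cast_ite, Nat.cast_one, Nat.cast_zero]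
    simp only [expCount]
    ring
  rw [expCount, treeExp_succ]
  simp only [h, mul_add]
  rw [Finset.sum_add_distrib, ← Finset.sum_mul, sum_choiceWeight hp hn, one_mul]
  simp only [← mul_add]
  rw [sum_choiceWeight_mul_fst hp fun e => expCount p t e.1.1 v + expCount p t e.1.2 v,
    pair_average_add hn fun j => expCount p t j v]

/-- Under a uniform root each of the `2 ^ t - 1` inner nodes has a uniform label. -/
lemma sum_expCount {p : BoolFun → ℝ} (hp : IsDistribution p) {n : ℕ} (hn : 2 ≤ n)
    (t : ℕ) (v : Fin n) : ∑ g, expCount p t g v = 2 ^ t - 1 := by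
  induction t with
  | zero => simp [expCount, treeExp_zero, labels, entries]
  | succ t ih =>
    have : (n : ℝ) ≠ 0 := by positivity
    simp only [expCount_succ hp hn, Finset.sum_add_distrib, ih, Finset.sum_const,
      Finset.card_univ, Fintype.card_fin, nsmul_eq_mul, Finset.sum_ite_eq', Finset.mem_univ,
      if_true]
    field_simp
    ring

/-- Union bound: a repetition involves the root, lies within one subtree, or is shared by the two
subtrees. -/
lemma not_nodup_indicator_le {α : Type*} [Fintype α] [DecidableEq α] (g : α) (l r : List α) :
    (if (g :: (l ++ r)).Nodup then (0 : ℝ) else 1) ≤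
      ((l.count g : ℝ) + r.count g) +
      ((if l.Nodup then 0 else 1) + (if r.Nodup then 0 else 1)) +
      ∑ v, (l.count v : ℝ) * r.count v := by
  have hs : 0 ≤ ∑ v, (l.count v : ℝ) * r.count v :=
    Finset.sum_nonneg fun v _ => by positivity
  have hl : (0 : ℝ) ≤ if l.Nodup then 0 else 1 := by split_ifs <;> simp
  have hr : (0 : ℝ) ≤ if r.Nodup then 0 else 1 := by split_ifs <;> simp
  have cl : (0 : ℝ) ≤ l.count g := Nat.cast_nonneg _
  have cr : (0 : ℝ) ≤ r.count g := Nat.cast_nonneg _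
  by_cases h : (g :: (l ++ r)).Nodup
  · rw [if_pos h]
    linarith
  rw [if_neg h]
  have one_le : ∀ {s : List α} {a : α}, a ∈ s → (1 : ℝ) ≤ s.count a := fun ha => by
    exact_mod_cast List.one_le_count_iff.2 ha
  by_cases h₁ : g ∈ l
  · linarith [one_le h₁]
  by_cases h₂ : g ∈ r
  · linarith [one_le h₂]
  by_cases h₃ : l.Nodup
  · by_cases h₄ : r.Nodup
    · have : ¬ l.Disjoint r := fun hd =>
        h (List.nodup_cons.2 ⟨by simp [h₁, h₂], List.nodup_append'.2 ⟨h₃, h₄, hd⟩⟩)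
      obtain ⟨v, hvl, hvr⟩ : ∃ v, v ∈ l ∧ v ∈ r := by
        by_contra! hne
        exact this fun v hl hr => hne v hl hr
      have h₅ : (1 : ℝ) ≤ ∑ v, (l.count v : ℝ) * r.count v :=
        (one_le_mul_of_one_le_of_one_le (one_le hvl) (one_le hvr)).trans
          (Finset.single_le_sum (f := fun v => (l.count v : ℝ) * r.count v)
            (fun v _ => by positivity) (Finset.mem_univ v))
      linarith
    · rw [if_neg h₄] at hr ⊢
      linarith
  · rw [if_neg h₃] at hl ⊢
    linarith

/-- Given the choice at the root, the subtrees are independent, so the expected number of shared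
labels is a product of `expCount`s summed over labels. Averaging over the input pair then makes
every new term O(4^t / n). -/
lemma collisionProb_le {p : BoolFun → ℝ} (hp : IsDistribution p) {n : ℕ} (hn : 2 ≤ n)
    (t : ℕ) (g : Fin n) : collisionProb p t g ≤ 2 * 4 ^ t / (n - 1) := by
  have hn' : (2 : ℝ) ≤ n := by exact_mod_cast hn
  have hpos : (0 : ℝ) < n - 1 := by linarith
  induction t generalizing g with
  | zero =>
    simp only [collisionProb, treeExp_zero, labels, entries, List.map_nil, List.nodup_nil, if_true]
    positivity
  | succ t ih =>
    set x : ℝ := 2 * 4 ^ t / (n - 1) with hx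
    have h : ∀ c : Choice n, (treeExp p t fun l => treeExp p t fun r =>
        if (labels (t + 1) ((c, l, r) : Unfolding n (t + 1)) g).Nodup then (0 : ℝ) else 1) ≤
        (expCount p t c.1.1.1 g + expCount p t c.1.1.2 g) + (x + x) +
          ∑ v, expCount p t c.1.1.1 v * expCount p t c.1.1.2 v := by
      intro c
      have h₁ := ih c.1.1.1
      have h₂ := ih c.1.1.2
      refine (treeExp_mono t hp fun l => treeExp_mono t hp fun r =>
        (labels_succ t c l r g ▸ not_nodup_indicator_le g (labels t l c.1.1.1)
          (labels t r c.1.1.2))).trans ?_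
      simp only [treeExp_add, treeExp_const t hp hn, treeExp_sum, treeExp_const_mul,
        treeExp_mul_const]
      simp only [expCount, collisionProb] at *
      linarith
    have h' : collisionProb p (t + 1) g ≤ ∑ c : Choice n, choiceWeight p c *
        ((expCount p t c.1.1.1 g + expCount p t c.1.1.2 g) + (x + x) +
          ∑ v, expCount p t c.1.1.1 v * expCount p t c.1.1.2 v) := by
      rw [collisionProb, treeExp_succ]
      exact Finset.sum_le_sum fun c _ =>
        mul_le_mul_of_nonneg_left (h c) (choiceWeight_nonneg hp c)
    refine h'.trans ?_
    rw [sum_choiceWeight_mul_fst hp fun e =>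
      (expCount p t e.1.1 g + expCount p t e.1.2 g) + (x + x) +
          ∑ v, expCount p t e.1.1 v * expCount p t e.1.2 v]
    simp only [Finset.sum_add_distrib (M := ℝ) (ι := InputPair n), mul_add]
    have hcard : 1 / (n.choose 2 : ℝ) * ∑ _e : InputPair n, x = x := by
      have := choose_two_pos hn
      rw [Finset.sum_const, Finset.card_univ, card_inputPair, nsmul_eq_mul]
      field_simp
    have hA := pair_average_add hn fun j => expCount p t j g
    rw [sum_expCount hp hn, Finset.sum_add_distrib, mul_add] at hA
    have hB := pair_average_le hn (fun j k => ∑ v, expCount p t j v * expCount p t k v)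
      (fun j k => by simp only [mul_comm])
      fun j => Finset.sum_nonneg fun v _ => mul_self_nonneg _
    have hC : ∑ j : Fin n, ∑ k : Fin n, ∑ v, expCount p t j v * expCount p t k v
        = n * (2 ^ t - 1) ^ 2 := by
      have : ∀ j : Fin n, ∑ k : Fin n, ∑ v, expCount p t j v * expCount p t k v =
          ∑ v, expCount p t j v * (2 ^ t - 1) := by
        intro j
        rw [Finset.sum_comm]
        simp only [← Finset.mul_sum, sum_expCount hp hn]
      simp only [this]
      rw [Finset.sum_comm]
      simp only [← Finset.sum_mul, sum_expCount hp hn, Finset.sum_const, Finset.card_univ,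
        Fintype.card_fin, nsmul_eq_mul]
      ring
    rw [hC] at hB
    rw [hA, hcard]
    have h2 : (1 : ℝ) ≤ 2 ^ t := one_le_pow₀ one_le_two
    have h4 : (4 : ℝ) ^ t = 2 ^ t * 2 ^ t := by rw [← mul_pow]; norm_num
    have e₁ : 1 / ((n : ℝ) * (n - 1)) * (n * (2 ^ t - 1) ^ 2) ≤ 4 ^ t / (n - 1) := by
      rw [show 1 / ((n : ℝ) * (n - 1)) * (n * (2 ^ t - 1) ^ 2) = (2 ^ t - 1) ^ 2 / (n - 1) by
        field_simp]
      gcongr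
      nlinarith
    have e₂ : 2 / (n : ℝ) * (2 ^ t - 1) ≤ 2 * 4 ^ t / (n - 1) := by
      rw [div_mul_eq_mul_div]
      refine div_le_div₀ (by positivity) ?_ hpos (by linarith)
      nlinarith
    -- The subtrees contribute `2 * x`, the root at most `2 * 4 ^ t / (n - 1)`, the shared labels at
    -- most `4 ^ t / (n - 1)`; one more `4 ^ t / (n - 1)` is slack.
    have e₃ : 2 * 4 ^ (t + 1) / ((n : ℝ) - 1) = 2 * x + 2 * 4 ^ t / (n - 1) +
        2 * (4 ^ t / (n - 1)) := by
      rw [hx]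
      ring
    have e₄ : 0 ≤ 4 ^ t / ((n : ℝ) - 1) := by positivity
    linarith

/-! ### Comparison of the automaton with the independent tree -/

/-- Since the gates in `L` are distinct, each new entry alters a single factor, from 1 to the weight
of the prescribed choice. -/
lemma prod_sum_constrained {p : BoolFun → ℝ} (hp : IsDistribution p) {n : ℕ} (hn : 2 ≤ n)
    (L : List (Fin n × Choice n)) (hL : (L.map Prod.fst).Nodup) :
    ∏ i, ∑ c : Choice n, choiceWeight p c * (if ∀ e ∈ L, e.1 = i → c = e.2 then 1 else 0) =
      (L.map fun e => choiceWeight p e.2).prod := by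
  induction L with
  | nil => simp [sum_choiceWeight hp hn]
  | cons a L ih =>
    rw [List.map_cons, List.nodup_cons] at hL
    have hne : ∀ e ∈ L, e.1 ≠ a.1 := fun e he h => hL.1 (h ▸ List.mem_map_of_mem he)
    rw [List.map_cons, List.prod_cons, ← ih hL.2,
      ← Finset.mul_prod_erase _ _ (Finset.mem_univ a.1),
      ← Finset.mul_prod_erase (a := a.1) Finset.univ
        (fun i => ∑ c : Choice n, choiceWeight p c * (if ∀ e ∈ L, e.1 = i → c = e.2 then 1 else 0))
        (Finset.mem_univ a.1)]
    have h₁ : ∀ c : Choice n, (∀ e ∈ a :: L, e.1 = a.1 → c = e.2) ↔ c = a.2 := by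
      intro c
      simp only [List.forall_mem_cons, forall_const]
      exact ⟨fun h => h.1, fun h => ⟨h, fun e he h' => absurd h' (hne e he)⟩⟩
    have h₂ : ∀ c : Choice n, (∀ e ∈ L, e.1 = a.1 → c = e.2) :=
      fun c e he h' => absurd h' (hne e he)
    have h₃ : ∀ i ∈ Finset.univ.erase a.1, ∀ c : Choice n,
        (∀ e ∈ a :: L, e.1 = i → c = e.2) ↔ ∀ e ∈ L, e.1 = i → c = e.2 := by
      intro i hi c
      have : a.1 ≠ i := (Finset.ne_of_mem_erase hi).symm
      simp [this]
    rw [Finset.prod_congr rfl fun i hi =>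
      Finset.sum_congr rfl fun c _ => by rw [if_congr (h₃ i hi c) rfl rfl]]
    simp only [h₁, if_pos (h₂ _), mul_one, sum_choiceWeight hp hn, one_mul, mul_ite, mul_zero,
      Finset.sum_ite_eq', Finset.mem_univ, if_true]

lemma autExp_entries {p : BoolFun → ℝ} (hp : IsDistribution p) {n : ℕ} (hn : 2 ≤ n)
    (L : List (Fin n × Choice n)) (hL : (L.map Prod.fst).Nodup) :
    (autExp p fun B : Automaton n => if ∀ e ∈ L, (B.1 e.1, B.2 e.1) = e.2 then 1 else 0) =
      (L.map fun e => choiceWeight p e.2).prod := by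
  rw [← prod_sum_constrained hp hn L hL, Finset.prod_univ_sum, Fintype.piFinset_univ, autExp,
    ← (Equiv.arrowProdEquivProdArrow (Fin n) (fun _ => InputPair n) fun _ => BoolFun).sum_comp]
  refine Finset.sum_congr rfl fun B _ => ?_
  rw [Finset.prod_mul_distrib, Finset.prod_ite_zero]
  simp only [Finset.prod_const_one, Finset.mem_univ, true_imp_iff]
  congr 1
  refine if_congr ⟨fun h i e he hi => hi ▸ h e he, fun h e he => h e.1 e he rfl⟩ rfl rfl

lemma weight_nonneg {p : BoolFun → ℝ} (hp : IsDistribution p) {n : ℕ} (B : Automaton n) :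
    0 ≤ weight p B :=
  Finset.prod_nonneg fun _ _ => mul_nonneg (by positivity) (hp.1 _)

lemma autExp_one {p : BoolFun → ℝ} (hp : IsDistribution p) {n : ℕ} (hn : 2 ≤ n) :
    (autExp p fun _ : Automaton n => 1) = 1 := by
  simpa using autExp_entries hp hn [] List.nodup_nil

/-- On the event that the labels are distinct, the unfolding of the random automaton is
distributed like a tree with independent choices. -/
lemma autExp_unfold_nodup {p : BoolFun → ℝ} (hp : IsDistribution p) {n : ℕ} (hn : 2 ≤ n)
    (t : ℕ) (g : Fin n) (φ : Unfolding n t → ℝ) :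
    (autExp p fun B => if (labels t (unfold B t g) g).Nodup then φ (unfold B t g) else 0) =
      treeExp p t fun τ => if (labels t τ g).Nodup then φ τ else 0 := by
  classical
  -- Conditioning on the tree: each tree with distinct labels has the same probability under both
  -- models.
  have h : ∀ B : Automaton n,
      (if (labels t (unfold B t g) g).Nodup then φ (unfold B t g) else 0) =
      ∑ τ, (if unfold B t g = τ then 1 else 0) * (if (labels t τ g).Nodup then φ τ else 0) := by
    intro B
    simp only [ite_mul, one_mul, zero_mul, Finset.sum_ite_eq, Finset.mem_univ, if_true]
  simp only [h, autExp, Finset.mul_sum, treeExp]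
  rw [Finset.sum_comm]
  refine Finset.sum_congr rfl fun τ _ => ?_
  split_ifs with hτ
  · rw [treeWeight_eq_prod p t τ g, ← autExp_entries hp hn _ hτ, autExp, Finset.sum_mul]
    refine Finset.sum_congr rfl fun B _ => ?_
    rw [mul_assoc]
    congr 2
    exact if_congr (unfold_eq_iff B t τ g) rfl rfl
  · simp

/-- The two models agree where labels are distinct. Both have total mass 1, so repetitions are
equally likely in both, and there `φ` is bounded by `M`. -/
lemma autExp_unfold_le {p : BoolFun → ℝ} (hp : IsDistribution p) {n : ℕ} (hn : 2 ≤ n)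
    (t : ℕ) (g : Fin n) (φ : Unfolding n t → ℝ) (hφ : ∀ τ, 0 ≤ φ τ) {M : ℝ} (hM : ∀ τ, φ τ ≤ M) :
    (autExp p fun B => φ (unfold B t g)) ≤ treeExp p t φ + M * collisionProb p t g := by
  have h₁ : (autExp p fun B => φ (unfold B t g)) ≤
      (autExp p fun B => if (labels t (unfold B t g) g).Nodup then φ (unfold B t g) else 0) +
        M * (autExp p (fun _ : Automaton n => 1) -
          autExp p fun B => if (labels t (unfold B t g) g).Nodup then 1 else 0) := by
    simp only [autExp, ← Finset.sum_sub_distrib, Finset.mul_sum, ← Finset.sum_add_distrib]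
    refine Finset.sum_le_sum fun B _ => ?_
    have := mul_le_mul_of_nonneg_left (hM (unfold B t g)) (weight_nonneg hp B)
    split_ifs <;> linarith
  have h₂ : collisionProb p t g = 1 - treeExp p t fun τ => if (labels t τ g).Nodup then 1 else 0 := by
    rw [eq_sub_iff_add_eq, collisionProb, ← treeExp_add]
    refine (congrArg (treeExp p t) (funext fun τ => ?_)).trans (treeExp_const t hp hn 1)
    split_ifs <;> simp
  rw [autExp_one hp hn, autExp_unfold_nodup hp hn t g φ, autExp_unfold_nodup hp hn t g fun _ => 1,
    ← h₂] at h₁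
  refine h₁.trans (add_le_add_left (treeExp_mono t hp fun τ => ?_) _)
  split_ifs
  · exact le_rfl
  · exact hφ τ


/-! ### Averages over the sixteen boolean functions -/

instance (f : BoolFun) : Decidable (Canalyzing f) := inferInstanceAs (Decidable (_ ∨ _))

instance (f : BoolFun) : Decidable (DependsFst f) := inferInstanceAs (Decidable (∃ _, _))

instance (f : BoolFun) : Decidable (DependsSnd f) := inferInstanceAs (Decidable (∃ _, _))

instance (f : BoolFun) : Decidable (f ∈ classA) :=
  inferInstanceAs (Decidable (∃ v, ∀ x₁ x₂, f x₁ x₂ = v))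

instance (f : BoolFun) : Decidable (f ∈ classB₂) := inferInstanceAs (Decidable (_ ∧ _))

instance (f : BoolFun) : Decidable (f ∈ classC) := inferInstanceAs (Decidable (¬ _))

/-- Reduces a statement about `f` to the sixteen explicit truth tables. -/
lemma boolFun_induction {P : BoolFun → Prop}
    (h : ∀ a b c d : Bool, P fun x y => cond x (cond y a b) (cond y c d)) (f : BoolFun) : P f := by
  have : f = fun x y =>
      cond x (cond y (f true true) (f true false)) (cond y (f false true) (f false false)) := by
    funext x y
    cases x <;> cases y <;> rfl
  rw [this]
  exact h _ _ _ _

/-- The number of arguments through which changes pass on average, if the other argument is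
forced to a uniformly random value. -/
def gain (f : BoolFun) : ℝ := 1 - (if f ∈ classA then 1 else 0) + (if f ∈ classC then 1 else 0)

/-- The probability that the value `o` is forced by `f` if the values of the arguments are forced
independently with distribution `m`. -/
def forcedProb (m : Option Bool → ℝ) (f : BoolFun) (o : Option Bool) : ℝ :=
  ∑ o₁, ∑ o₂, m o₁ * (m o₂ * if forced f o₁ o₂ = o then 1 else 0)

section

variable {m : Option Bool → ℝ}

/-- Write m for `m none` and q = (1 - m) / 2. Conjunction is undetermined with probability (1 - q)²
- q² = m, and likewise all of `classB₂`; functions of one argument also give m, constants 0, and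
exclusive or gives 1 - (1 - m)² ≤ 2m. -/
lemma forcedProb_none_le (h : m (some true) = m (some false))
    (h1 : ∑ o, m o = 1) (f : BoolFun) : forcedProb m f none ≤ m none * gain f := by
  have e : m none = 1 - 2 * m (some false) := by
    simp only [Fintype.sum_option, Fintype.sum_bool, h] at h1
    linarith
  induction f using boolFun_induction with | h a b c d
  cases a <;> cases b <;> cases c <;> cases d <;>
    simp (decide := true) only [forcedProb, gain, Fintype.sum_option, Fintype.sum_bool, if_true,
      if_false, h] <;> rw [e] at * <;>
    nlinarith [mul_self_nonneg (1 - 2 * m (some false))]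

/-- The term `m none` is needed for `classB₂`: each argument is blocked with probability (1 - m) /
2, which leaves 1 + m in total, where m is `m none`. -/
lemma passes_le (h0 : 0 ≤ m none) (h : m (some true) = m (some false))
    (h1 : ∑ o, m o = 1) (f : BoolFun) :
    ∑ o, m o * (if PassesFst f o then 1 else 0) + ∑ o, m o * (if PassesSnd f o then 1 else 0) ≤
      gain f + m none := by
  have e : m none = 1 - 2 * m (some false) := by
    simp only [Fintype.sum_option, Fintype.sum_bool, h] at h1
    linarith
  induction f using boolFun_induction with | h a b c d
  cases a <;> cases b <;> cases c <;> cases d <;>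
    simp (decide := true) only [gain, Fintype.sum_option, Fintype.sum_bool, if_true,
      if_false, h] <;> linarith

lemma forcedProb_neg (f : BoolFun) (v : Bool) :
    forcedProb m (neg f) (some v) = forcedProb m f (some !v) := by
  have key : ∀ o₁ o₂, forced (neg f) o₁ o₂ = some v ↔ forced f o₁ o₂ = some !v := by
    induction f using boolFun_induction with | h a b c d
    revert a b c d v
    decide
  simp only [forcedProb, key]

/-- The remaining functions are projections, their negations, equivalence and exclusive or; balanced
inputs give them balanced outputs without any symmetry of `p`. -/
lemma forcedProb_balanced (h : m (some true) = m (some false)) {f : BoolFun}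
    (hf : f ∉ classA ∪ classB₂) :
    forcedProb m f (some true) = forcedProb m f (some false) := by
  have hf' : ¬ (f ∈ classA ∨ f ∈ classB₂) := hf
  clear hf
  induction f using boolFun_induction with | h a b c d
  revert hf'
  cases a <;> cases b <;> cases c <;> cases d <;>
    simp (decide := true) only [forcedProb, Fintype.sum_option, Fintype.sum_bool, if_true,
      if_false, h, true_imp_iff, false_imp_iff] <;> ring

/-- Negation reverses the sign of the bias of each function. Where the bias may be nonzero, `p` is
invariant under negation, so the total bias equals its own negative. -/
lemma sum_forcedProb_balanced {p : BoolFun → ℝ} (hsymm : IsSymmetric p)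
    (h : m (some true) = m (some false)) :
    ∑ f, p f * forcedProb m f (some true) = ∑ f, p f * forcedProb m f (some false) := by
  have hneg : Function.Involutive neg := fun f => by funext x y; simp [neg]
  have h₁ : ∑ f, p f * forcedProb m f (some true) =
      ∑ f, p (neg f) * forcedProb m f (some false) := by
    rw [← (Equiv.ofBijective neg hneg.bijective).sum_comp]
    simp [forcedProb_neg]
  have h₂ : ∑ f, p f * forcedProb m f (some false) =
      ∑ f, p (neg f) * forcedProb m f (some true) := by
    rw [← (Equiv.ofBijective neg hneg.bijective).sum_comp]
    simp [forcedProb_neg]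
  have h₃ : ∑ f, (p f - p (neg f)) *
      (forcedProb m f (some true) - forcedProb m f (some false)) = 0 := by
    refine Finset.sum_eq_zero fun f _ => ?_
    by_cases hf : f ∈ classA ∪ classB₂
    · rw [hsymm.1 f hf, sub_self, zero_mul]
    · rw [forcedProb_balanced h hf, sub_self, mul_zero]
  simp only [sub_mul, mul_sub, Finset.sum_sub_distrib] at h₃
  linarith

end

/-! ### Decay of the expected influence -/

/-- The growth rate `1 - a + c` of the influence of a perturbation. -/
noncomputable def rate (p : BoolFun → ℝ) : ℝ := 1 - classProb p classA + classProb p classC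

lemma sum_gain {p : BoolFun → ℝ} (hp : IsDistribution p) : ∑ f, p f * gain f = rate p := by
  simp only [gain, mul_add, mul_sub, mul_one, mul_ite, mul_zero, Finset.sum_add_distrib,
    Finset.sum_sub_distrib, hp.2, rate, classProb]
  congr! 5

lemma rate_nonneg {p : BoolFun → ℝ} (hp : IsDistribution p) : 0 ≤ rate p := by
  rw [← sum_gain hp]
  refine Finset.sum_nonneg fun f _ => mul_nonneg (hp.1 f) ?_
  unfold gain
  split_ifs <;> norm_num

/-- The distribution of the forced value at the root of a tree with independent choices. -/
noncomputable def valueProb (p : BoolFun → ℝ) (n t : ℕ) (o : Option Bool) : ℝ :=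
  treeExp p t fun τ : Unfolding n t => if rootValue t τ = o then 1 else 0

/-- The expected influence in a tree with independent choices. -/
noncomputable def expInfluence (p : BoolFun → ℝ) (n t : ℕ) : ℝ :=
  treeExp p t fun τ : Unfolding n t => (influence t τ : ℝ)

section

variable {p : BoolFun → ℝ} {n : ℕ}

lemma treeExp_rootValue (t : ℕ) (ψ : Option Bool → ℝ) :
    (treeExp p t fun τ : Unfolding n t => ψ (rootValue t τ)) = ∑ o, valueProb p n t o * ψ o := by
  have : ∀ τ : Unfolding n t, ψ (rootValue t τ) =
      ∑ o, (if rootValue t τ = o then 1 else 0) * ψ o := fun τ => by simp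
  simp only [this, treeExp_sum, treeExp_mul_const]
  rfl

lemma valueProb_nonneg (hp : IsDistribution p) (t : ℕ) (o : Option Bool) :
    0 ≤ valueProb p n t o :=
  treeExp_nonneg t hp fun τ => by split_ifs <;> simp

lemma sum_valueProb (hp : IsDistribution p) (hn : 2 ≤ n) (t : ℕ) :
    ∑ o, valueProb p n t o = 1 := by
  simpa [treeExp_const t hp hn] using (treeExp_rootValue (p := p) (n := n) t fun _ => 1).symm

lemma valueProb_succ (hn : 2 ≤ n) (t : ℕ) (o : Option Bool) :
    valueProb p n (t + 1) o = ∑ f, p f * forcedProb (valueProb p n t) f o := by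
  rw [← sum_choiceWeight_mul_snd p hn, valueProb, treeExp_succ]
  refine Finset.sum_congr rfl fun c _ => ?_
  congr 1
  have h : ∀ l r : Unfolding n t, rootValue (t + 1) ((c, l, r) : Unfolding n (t + 1)) =
      forced c.2 (rootValue t l) (rootValue t r) := fun _ _ => rfl
  simp only [h, forcedProb]
  have h' : ∀ o₁, (treeExp p t fun r : Unfolding n t =>
      if forced c.2 o₁ (rootValue t r) = o then (1 : ℝ) else 0) =
      ∑ o₂, valueProb p n t o₂ * if forced c.2 o₁ o₂ = o then (1 : ℝ) else 0 :=
    fun o₁ => treeExp_rootValue t fun o₂ => if forced c.2 o₁ o₂ = o then (1 : ℝ) else 0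
  simp only [h']
  rw [treeExp_rootValue t fun o₁ =>
    ∑ o₂, valueProb p n t o₂ * if forced c.2 o₁ o₂ = o then (1 : ℝ) else 0]
  simp only [Finset.mul_sum]

lemma valueProb_balanced (hsymm : IsSymmetric p) (hn : 2 ≤ n) (t : ℕ) :
    valueProb p n t (some true) = valueProb p n t (some false) := by
  induction t with
  | zero => simp [valueProb, treeExp_zero, rootValue]
  | succ t ih => rw [valueProb_succ hn, valueProb_succ hn, sum_forcedProb_balanced hsymm ih]

lemma valueProb_none_le (hp : IsDistribution p) (hsymm : IsSymmetric p) (hn : 2 ≤ n) (t : ℕ) :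
    valueProb p n t none ≤ rate p ^ t := by
  induction t with
  | zero => simp [valueProb, treeExp_zero, rootValue]
  | succ t ih =>
    rw [valueProb_succ hn, pow_succ]
    calc _ ≤ ∑ f, valueProb p n t none * (p f * gain f) := by
          refine Finset.sum_le_sum fun f _ => ?_
          rw [mul_left_comm]
          exact mul_le_mul_of_nonneg_left (forcedProb_none_le
            (valueProb_balanced hsymm hn t) (sum_valueProb hp hn t) f) (hp.1 f)
      _ = valueProb p n t none * rate p := by rw [← Finset.mul_sum, sum_gain hp]
      _ ≤ _ := mul_le_mul_of_nonneg_right ih (rate_nonneg hp)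

lemma expInfluence_nonneg (hp : IsDistribution p) (t : ℕ) : 0 ≤ expInfluence p n t :=
  treeExp_nonneg t hp fun _ => Nat.cast_nonneg _

/-- Whether the influence of one subtree counts depends only on the forced value of the other, and
the two are independent, so the expectation factors. -/
lemma expInfluence_succ (hn : 2 ≤ n) (t : ℕ) :
    expInfluence p n (t + 1) = ∑ f, p f * (expInfluence p n t *
      (∑ o, valueProb p n t o * (if PassesFst f o then 1 else 0) +
        ∑ o, valueProb p n t o * (if PassesSnd f o then 1 else 0))) := by
  rw [← sum_choiceWeight_mul_snd p hn, expInfluence, treeExp_succ]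
  refine Finset.sum_congr rfl fun c _ => ?_
  congr 1
  have h : ∀ l r : Unfolding n t,
      (influence (t + 1) ((c, l, r) : Unfolding n (t + 1)) : ℝ) =
      (influence t l : ℝ) * (if PassesFst c.2 (rootValue t r) then 1 else 0) +
      (if PassesSnd c.2 (rootValue t l) then 1 else 0) * (influence t r : ℝ) := by
    intro l r
    simp [influence]
  simp only [h, treeExp_add, treeExp_const_mul, treeExp_mul_const]
  rw [treeExp_rootValue t fun o => if PassesFst c.2 o then (1 : ℝ) else 0,
    treeExp_rootValue t fun o => if PassesSnd c.2 o then (1 : ℝ) else 0, expInfluence]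
  ring

lemma expInfluence_succ_le (hp : IsDistribution p) (hsymm : IsSymmetric p) (hn : 2 ≤ n) (t : ℕ) :
    expInfluence p n (t + 1) ≤ expInfluence p n t * (rate p + rate p ^ t) := by
  rw [expInfluence_succ hn]
  calc _ ≤ ∑ f, (expInfluence p n t * (p f * gain f) +
        expInfluence p n t * valueProb p n t none * p f) := by
        refine Finset.sum_le_sum fun f _ => ?_
        have := mul_le_mul_of_nonneg_left (passes_le (valueProb_nonneg hp t _)
          (valueProb_balanced hsymm hn t)
          (sum_valueProb hp hn t) f)
          (mul_nonneg (hp.1 f) (expInfluence_nonneg (n := n) hp t))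
        linarith
    _ = expInfluence p n t * (rate p + valueProb p n t none) := by
        rw [Finset.sum_add_distrib, ← Finset.mul_sum, ← Finset.mul_sum, sum_gain hp, hp.2]
        ring
    _ ≤ _ := mul_le_mul_of_nonneg_left
        (by linarith [valueProb_none_le (n := n) hp hsymm hn t]) (expInfluence_nonneg hp t)

end

/-- The influence decays at every rate above `rate p`, uniformly in the number of gates. -/
lemma exists_expInfluence_le {p : BoolFun → ℝ} (hp : IsDistribution p) (hsymm : IsSymmetric p)
    {μ : ℝ} (hμ : rate p < μ) (hμ1 : μ < 1) :
    ∃ C : ℝ, 0 ≤ C ∧ ∃ T : ℕ, ∀ n, 2 ≤ n → ∀ t, T ≤ t → expInfluence p n t ≤ C * μ ^ t := by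
  have hr := rate_nonneg hp
  have hμ0 : 0 < μ := hr.trans_lt hμ
  -- From level `T` on, the growth factor `rate p + rate p ^ t` is below `μ`; the constant absorbs
  -- the trivial bound `2 ^ T` for the first levels.
  obtain ⟨T, hT⟩ := exists_pow_lt_of_lt_one (sub_pos.2 hμ) (hμ.trans hμ1)
  refine ⟨2 ^ T / μ ^ T, by positivity, T, fun n hn t ht => ?_⟩
  induction t, ht using Nat.le_induction with
  | base =>
    rw [div_mul_cancel₀ _ (by positivity)]
    refine (treeExp_mono T hp fun τ => ?_).trans (treeExp_const T hp hn (2 ^ T)).le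
    exact_mod_cast influence_le T τ
  | succ t ht ih =>
    calc _ ≤ _ := expInfluence_succ_le hp hsymm hn t
      _ ≤ (2 ^ T / μ ^ T * μ ^ t) * μ := by
        have : rate p ^ t ≤ rate p ^ T := pow_le_pow_of_le_one hr (hμ.trans hμ1).le ht
        exact mul_le_mul ih (by linarith) (by positivity) (by positivity)
      _ = _ := by ring

/-! ### First moment bound and Markov's inequality -/

/-- The expected number of gates that are not weak. -/
lemma autExp_not_isWeak_le {p : BoolFun → ℝ} (hp : IsDistribution p) {n : ℕ} (hn : 2 ≤ n) (t : ℕ) :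
    (autExp p fun B : Automaton n => ({i | ¬ IsWeak B i}.ncard : ℝ)) ≤
      n * (expInfluence p n t + 2 ^ t * (2 * 4 ^ t / (n - 1))) := by
  calc _ ≤ autExp p fun B : Automaton n => ∑ g, (influence t (unfold B t g) : ℝ) :=
        Finset.sum_le_sum fun B _ => mul_le_mul_of_nonneg_left
          (by beta_reduce; exact_mod_cast ncard_not_isWeak_le B t) (weight_nonneg hp B)
    _ = ∑ g, autExp p fun B : Automaton n => (influence t (unfold B t g) : ℝ) := by
        simp only [autExp, Finset.mul_sum]
        exact Finset.sum_comm
    _ ≤ ∑ _g : Fin n, (expInfluence p n t + 2 ^ t * (2 * 4 ^ t / (n - 1))) := by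
        refine Finset.sum_le_sum fun g _ => ?_
        refine (autExp_unfold_le hp hn t g (fun τ => (influence t τ : ℝ))
          (fun _ => Nat.cast_nonneg _) (M := 2 ^ t)
          fun τ => by exact_mod_cast influence_le t τ).trans ?_
        have := collisionProb_le hp hn t g
        rw [expInfluence]
        gcongr
    _ = _ := by
        rw [Finset.sum_const, Finset.card_univ, Fintype.card_fin, nsmul_eq_mul]

lemma pr_eq_autExp (p : BoolFun → ℝ) (n : ℕ) (P : Automaton n → Prop) [DecidablePred P] :
    pr p n P = autExp p fun B => if P B then 1 else 0 := by
  simp only [pr, autExp, mul_ite, mul_one, mul_zero]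
  congr! 2

lemma pr_le_one {p : BoolFun → ℝ} (hp : IsDistribution p) {n : ℕ} (hn : 2 ≤ n)
    (P : Automaton n → Prop) : pr p n P ≤ 1 := by
  classical
  rw [pr_eq_autExp]
  refine le_trans ?_ (autExp_one hp hn).le
  refine Finset.sum_le_sum fun B _ => mul_le_mul_of_nonneg_left ?_ (weight_nonneg hp B)
  beta_reduce
  split_ifs <;> simp

/-- Markov's inequality for the number of gates that are not weak. -/
lemma one_sub_le_pr {p : BoolFun → ℝ} (hp : IsDistribution p) {n : ℕ} (hn : 2 ≤ n) (α : ℝ) (t : ℕ) :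
    1 - (n : ℝ) ^ α * (expInfluence p n t + 2 ^ t * (2 * 4 ^ t / (n - 1))) ≤
      pr p n (fun B => (n : ℝ) * (1 - (n : ℝ) ^ (-α)) ≤ ({i | IsWeak B i}.ncard : ℝ)) := by
  classical
  have hn0 : (0 : ℝ) < n := by positivity
  have hα : (0 : ℝ) < (n : ℝ) ^ α := Real.rpow_pos_of_pos hn0 α
  -- Pointwise form of Markov's inequality: on failure at least n · n^(-α) gates are not weak, so
  -- the left side is at most 0.
  have h₁ : ∀ B : Automaton n,
      1 - (n : ℝ) ^ α / n * ({i | ¬ IsWeak B i}.ncard : ℝ) ≤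
      if (n : ℝ) * (1 - (n : ℝ) ^ (-α)) ≤ ({i | IsWeak B i}.ncard : ℝ) then 1 else 0 := by
    intro B
    split_ifs with h
    · have : 0 ≤ (n : ℝ) ^ α / n * ({i | ¬ IsWeak B i}.ncard : ℝ) := by positivity
      linarith
    · have hc : ({i | IsWeak B i}.ncard : ℝ) + ({i | ¬ IsWeak B i}.ncard : ℝ) = n := by
        have := Set.ncard_add_ncard_compl {i | IsWeak B i}
        rw [Nat.card_fin] at this
        exact_mod_cast this
      have h₂ : (n : ℝ) * (n : ℝ) ^ (-α) ≤ ({i | ¬ IsWeak B i}.ncard : ℝ) := by linarith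
      have h₃ : (1 : ℝ) = (n : ℝ) ^ α / n * (n * (n : ℝ) ^ (-α)) := by
        rw [Real.rpow_neg hn0.le]
        field_simp
      have := mul_le_mul_of_nonneg_left h₂ (by positivity : 0 ≤ (n : ℝ) ^ α / n)
      linarith
  rw [pr_eq_autExp]
  have h₂ := Finset.sum_le_sum fun (B : Automaton n) (_ : B ∈ Finset.univ) =>
    mul_le_mul_of_nonneg_left (h₁ B) (weight_nonneg hp B)
  have h₃ : ∑ B : Automaton n, weight p B * (1 - (n : ℝ) ^ α / n * ({i | ¬ IsWeak B i}.ncard : ℝ)) =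
      1 - (n : ℝ) ^ α / n * autExp p fun B : Automaton n => ({i | ¬ IsWeak B i}.ncard : ℝ) := by
    refine Eq.trans ?_ (congrArg (· - _) (autExp_one hp hn))
    simp only [autExp, Finset.mul_sum, ← Finset.sum_sub_distrib]
    refine Finset.sum_congr rfl fun B _ => ?_
    ring
  rw [h₃] at h₂
  refine le_trans ?_ h₂
  have := mul_le_mul_of_nonneg_left (autExp_not_isWeak_le hp hn t)
    (by positivity : 0 ≤ (n : ℝ) ^ α / n)
  have e : (n : ℝ) ^ α / n * (n * (expInfluence p n t + 2 ^ t * (2 * 4 ^ t / (n - 1)))) =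
      (n : ℝ) ^ α * (expInfluence p n t + 2 ^ t * (2 * 4 ^ t / (n - 1))) := by
    field_simp
  linarith

end BCA

/-! ### Choice of the depth and of the exponent -/

theorem theorem4p5 (p : BCA.BoolFun → ℝ)
    (hp : BCA.IsDistribution p) (hsymm : BCA.IsSymmetric p)
    (hac : BCA.classProb p BCA.classC < BCA.classProb p BCA.classA) :
    ∃ α : ℝ, 0 < α ∧
      Tendsto
        (fun n : ℕ => BCA.pr p n (fun B =>
          (n : ℝ) * (1 - (n : ℝ) ^ (-α)) ≤ ({i | BCA.IsWeak B i}.ncard : ℝ)))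
        atTop (𝓝 1) := by
  have hrate : BCA.rate p < 1 := by
    unfold BCA.rate
    linarith
  obtain ⟨μ, hμ, hμ1⟩ := exists_between hrate
  have hμ0 : 0 < μ := (BCA.rate_nonneg hp).trans_lt hμ
  obtain ⟨C, hC, T, hT⟩ := BCA.exists_expInfluence_le hp hsymm hμ hμ1
  -- With depth `t = Nat.log 64 n`, the influence is of order `μ ^ t` and the collision term of
  -- order `8 ^ t / n ≤ (1 / 8) ^ t`. The Markov factor `n ^ α`, of order `ρ ^ t`, must be beaten by
  -- both, whence `ρ < μ⁻¹` and `ρ < 8`; `1 < ρ` makes `α` positive.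
  obtain ⟨ρ, hρ1, hρ⟩ := exists_between (lt_min ((one_lt_inv₀ hμ0).2 hμ1) (by norm_num : (1 : ℝ) < 8))
  have hρμ : ρ * μ < 1 := by
    rw [← lt_inv_mul_iff₀' hμ0, mul_one]
    exact hρ.trans_le (min_le_left _ _)
  have hρ8 : ρ / 8 < 1 := by
    rw [div_lt_one (by norm_num)]
    exact hρ.trans_le (min_le_right _ _)
  have hρ0 : 0 < ρ := by linarith
  have hlog : 0 < Real.log 64 := Real.log_pos (by norm_num)
  refine ⟨Real.log ρ / Real.log 64, div_pos (Real.log_pos hρ1) hlog, ?_⟩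
  set α := Real.log ρ / Real.log 64 with hα
  have h64 : (64 : ℝ) ^ α = ρ := by
    rw [Real.rpow_def_of_pos (by norm_num), hα, mul_div_cancel₀ _ hlog.ne', Real.exp_log hρ0]
  have htend : Tendsto (fun n : ℕ => Nat.log 64 n) atTop atTop := by
    refine tendsto_atTop.2 fun b => ?_
    filter_upwards [eventually_ge_atTop (64 ^ b)] with n hn
    exact Nat.le_log_of_pow_le (by norm_num) hn
  have hlim : Tendsto (fun t : ℕ => 1 - (ρ * C * (ρ * μ) ^ t + 4 * ρ * (ρ / 8) ^ t))
      atTop (𝓝 1) := by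
    have h₁ := (tendsto_pow_atTop_nhds_zero_of_lt_one (by positivity) hρμ).const_mul (ρ * C)
    have h₂ := (tendsto_pow_atTop_nhds_zero_of_lt_one (by positivity) hρ8).const_mul (4 * ρ)
    simpa using (h₁.add h₂).const_sub 1
  refine tendsto_of_tendsto_of_tendsto_of_le_of_le' (hlim.comp htend) tendsto_const_nhds ?_ ?_
  · filter_upwards [eventually_ge_atTop 2, htend.eventually_ge_atTop T] with n hn ht
    refine le_trans ?_ (BCA.one_sub_le_pr hp hn α (Nat.log 64 n))
    have hlow : (64 : ℝ) ^ Nat.log 64 n ≤ n := by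
      exact_mod_cast Nat.pow_log_le_self 64 (by omega)
    have hup : (n : ℝ) ≤ 64 ^ (Nat.log 64 n + 1) := by
      exact_mod_cast (Nat.lt_pow_succ_log_self (by norm_num) n).le
    simp only [Function.comp]
    generalize Nat.log 64 n = t at *
    have hn' : (2 : ℝ) ≤ n := by exact_mod_cast hn
    have hnα : (n : ℝ) ^ α ≤ ρ * ρ ^ t := by
      calc (n : ℝ) ^ α ≤ ((64 : ℝ) ^ (t + 1)) ^ α :=
            Real.rpow_le_rpow (by positivity) hup (div_pos (Real.log_pos hρ1) hlog).le
        _ = ρ * ρ ^ t := by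
            rw [← Real.rpow_natCast, ← Real.rpow_mul (by norm_num), mul_comm, Real.rpow_mul
              (by norm_num), h64, Real.rpow_natCast, pow_succ']
    have hcoll : (2 : ℝ) ^ t * (2 * 4 ^ t / (n - 1)) ≤ 4 * (1 / 8) ^ t := by
      -- For `2 ≤ n`, `n - 1` is at least `n / 2`.
      have hle : (64 : ℝ) ^ t / 2 ≤ n - 1 := by linarith
      calc (2 : ℝ) ^ t * (2 * 4 ^ t / (n - 1)) ≤ 2 ^ t * (2 * 4 ^ t / (64 ^ t / 2)) := by
            gcongr
        _ = 4 * (2 * 4 / 64) ^ t := by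
            rw [div_pow, mul_pow]
            field_simp
            ring
        _ = _ := by norm_num
    have hd := hT n hn t ht
    have hd0 := BCA.expInfluence_nonneg (n := n) hp t
    have h0 : (0 : ℝ) ≤ 2 ^ t * (2 * 4 ^ t / (n - 1)) := by
      have : (0 : ℝ) ≤ n - 1 := by linarith
      positivity
    have := mul_le_mul hnα (add_le_add hd hcoll) (by positivity) (by positivity)
    have e : ρ * ρ ^ t * (C * μ ^ t + 4 * (1 / 8) ^ t) =
        ρ * C * (ρ * μ) ^ t + 4 * ρ * (ρ / 8) ^ t := by
      rw [mul_pow, div_eq_mul_one_div ρ 8, mul_pow]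
      ring
    linarith
  · filter_upwards [eventually_ge_atTop 2] with n hn
    exact BCA.pr_le_one hp hn _
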